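/- Let $\Gamma=(V,\sim)$ be a connected, locally finite simple graph with a faithful, adjacency-preserving action of $G=\mathbb{Z}^d$ on $V$ that has finitely many orbits. Assume that $\Gamma$ has one crossing edge per generator: there is a set $F\subset V$ containing exactly one vertex of each orbit such that there are exactly $2d$ pairs $(u,w)$ with $u\in F$, $w\in V\setminus F$ and $u\sim w$. Fix such an $F$, and put $N=|F|$. A crossing edge is a pair $(u,v)\in F\times F$ such that $u\sim gv$ for some $g\in G$ with $gv\notin F$. Let $H$ be a periodic self-adjoint operator on $\ell^2(V)$, that is, $(Hf)_u=H_{u,u}f_u+\sum_{v\sim u}H_{u,v}f_v$ with $H_{v,u}=\overline{H_{u,v}}\in\mathbb{C}$, $H_{gu,gv}=H_{u,v}$ for all $g\in G$, and $H_{u,v}\neq0$ whenever $u\sim v$. Let $g_1,\dots,g_d$ be generators of $G$ and, for $\alpha\in\mathbb{T}^d=(\mathbb{R}/2\pi\mathbb{Z})^d$, let $\chi_\alpha$ be the character of $G$ with $\chi_\alpha(g_j)=e^{i\alpha_j}$. Let $T(\alpha)$ be the Hermitian $N\times N$ matrix with entries $$T(\alpha)_{u,v}=\sum_{g\in G}H_{u,gv}\,\chi_\alpha(g),\qquad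 u,v\in F,$$ and let $\lambda_1(T(\alpha))\le\dots\le\lambda_N(T(\alpha))$ be its eigenvalues, repeated according to multiplicity. Fix $1\le n\le N$, write $\lambda(\alpha)=\lambda_n(T(\alpha))$, and let $\alpha^\circ\in\mathbb{T}^d$ be a critical point of $\lambda$ such that $\lambda(\alpha^\circ)$ is a simple eigenvalue of $T(\alpha^\circ)$. Let $f^\circ$ be a corresponding normalized eigenvector, and suppose that for every crossing edge $(u,v)$ at least one of $f^\circ_u$, $f^\circ_v$ is nonzero. Define $$B=D\big(T(\alpha)f^\circ\big)\Big|_{\alpha=\alpha^\circ}\in\mathbb{C}^{N\times d},\qquad \Omega=\tfrac12\operatorname{Hess}\,\langle f^\circ,T(\alpha)f^\circ\rangle\Big|_{\alpha=\alpha^\circ}\in\mathbb{R}^{d\times d},$$ $$W=\Omega-B^*\big(T(\alpha^\circ)-\lambda(\alpha^\circ)\big)^+B,$$ where $D$ and $\operatorname{Hess}$ are taken with respect to $\alpha_1,\dots,\alpha_d$, and $^+$ denotes the Moore–Penrose pseudoinverse. 1. If $W\ge0$ (positive semidefinite), then $\lambda(\alpha^\circ)\le\lambda(\alpha)$ for all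 $\alpha\in\mathbb{T}^d$. 2. If $W\le0$ (negative semidefinite), then $\lambda(\alpha)\le\lambda(\alpha^\circ)$ for all $\alpha\in\mathbb{T}^d$. -/

import Mathlib

open scoped Matrix lp ComplexOrder

noncomputable section

namespace FloquetBloch

/-- `Γ` is a `ℤ^d`-periodic graph: a locally finite simple graph together with a faithful cofinite
action of `ℤ^d` on its vertices that preserves adjacency. -/
structure IsPeriodicGraph {d : ℕ} {V : Type*} [AddAction (Fin d → ℤ) V]
    (Γ : SimpleGraph V) : Prop where
  locally_finite : ∀ v : V, (Γ.neighborSet v).Finite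
  adj_vadd_iff : ∀ (g : Fin d → ℤ) (u v : V), Γ.Adj (g +ᵥ u) (g +ᵥ v) ↔ Γ.Adj u v
  faithful : FaithfulVAdd (Fin d → ℤ) V
  cofinite : Finite (AddAction.orbitRel.Quotient (Fin d → ℤ) V)

/-- `F` contains exactly one representative of each `ℤ^d`-orbit. (As a periodic graph has finitely
many orbits, its fundamental domains are finite, so taking `F` to be a `Finset` is no loss.) -/
def IsFundDomain {d : ℕ} {V : Type*} [AddAction (Fin d → ℤ) V] (F : Finset V) : Prop :=
  ∀ v : V, ∃! u : V, u ∈ F ∧ u ∈ AddAction.orbit (Fin d → ℤ) v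

/-- The ordered pairs of adjacent vertices `u ∼ w` with `u ∈ F` and `w ∉ F`. -/
def crossingPairs {V : Type*} (Γ : SimpleGraph V) (F : Finset V) : Set (V × V) :=
  {p | p.1 ∈ F ∧ p.2 ∉ F ∧ Γ.Adj p.1 p.2}

/-- `(u, v)`, with `u, v ∈ F`, is a crossing edge: `u` is adjacent to a translate of `v` that lies
outside of `F`. -/
def IsCrossingEdge {d : ℕ} {V : Type*} [AddAction (Fin d → ℤ) V] (Γ : SimpleGraph V)
    (F : Finset V) (u v : F) : Prop :=
  ∃ g : Fin d → ℤ, g +ᵥ (v : V) ∉ F ∧ Γ.Adj (u : V) (g +ᵥ (v : V))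

/-- The matrix element `H_{u,v}` of an operator on `ℓ²(V)`: the value at `u` of `H δ_v`. -/
def entry {V : Type*} [DecidableEq V] (H : ℓ²(V, ℂ) →L[ℂ] ℓ²(V, ℂ)) (u v : V) : ℂ :=
  (H (lp.single 2 v (1 : ℂ))) u

/-- `H` is a periodic self-adjoint operator on `ℓ²(Γ)`. Together with the continuity of `H`, the
field `entry_eq_zero` says that `(H f)_u` is the sum of `H_{u,v} f_v` over `v = u` and the
neighbours `v` of `u`. -/
structure IsPeriodicOperator {d : ℕ} {V : Type*} [AddAction (Fin d → ℤ) V] [DecidableEq V]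
    (Γ : SimpleGraph V) (H : ℓ²(V, ℂ) →L[ℂ] ℓ²(V, ℂ)) : Prop where
  self_adjoint : IsSelfAdjoint H
  entry_eq_zero : ∀ u v : V, u ≠ v → ¬ Γ.Adj u v → entry H u v = 0
  entry_ne_zero : ∀ u v : V, Γ.Adj u v → entry H u v ≠ 0
  periodic : ∀ (g : Fin d → ℤ) (u v : V), entry H (g +ᵥ u) (g +ᵥ v) = entry H u v

/-- The character `χ_α` of `ℤ^d` with `χ_α(b j) = exp (i α_j)` for the generators `b j`. -/
def character {d : ℕ} (b : Module.Basis (Fin d) ℤ (Fin d → ℤ)) (α : Fin d → ℝ)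
    (g : Fin d → ℤ) : ℂ :=
  Complex.exp (Complex.I * ∑ j, (α j : ℂ) * (b.repr g j : ℂ))

/-- The Floquet--Bloch transformed operator `T(α)`, an `F × F` matrix with entries
`T(α)_{u,v} = ∑_g H_{u,gv} χ_α(g)`. The quasimomentum `α` ranges over `ℝ^d`, on which `T` is
`2π`-periodic in each coordinate. (For a connected periodic graph the action is free, so the sum
has finitely many nonzero terms by local finiteness.) -/
def floquet {d : ℕ} {V : Type*} [AddAction (Fin d → ℤ) V] [DecidableEq V] (F : Finset V)
    (b : Module.Basis (Fin d) ℤ (Fin d → ℤ)) (H : ℓ²(V, ℂ) →L[ℂ] ℓ²(V, ℂ))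
    (α : Fin d → ℝ) : Matrix F F ℂ :=
  Matrix.of fun u v => ∑ᶠ g : Fin d → ℤ, entry H (u : V) (g +ᵥ (v : V)) * character b α g

theorem entry_conj {V : Type*} [DecidableEq V] {H : ℓ²(V, ℂ) →L[ℂ] ℓ²(V, ℂ)}
    (hH : IsSelfAdjoint H) (u v : V) : star (entry H u v) = entry H v u := by
  have h := hH.isSymmetric (lp.single 2 v (1 : ℂ)) (lp.single 2 u (1 : ℂ))
  simp only [ContinuousLinearMap.coe_coe, lp.inner_single_left, lp.inner_single_right] at h
  simpa [entry] using h

theorem character_neg {d : ℕ} (b : Module.Basis (Fin d) ℤ (Fin d → ℤ)) (α : Fin d → ℝ)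
    (g : Fin d → ℤ) : character b α (-g) = star (character b α g) := by
  simp [character, ← Complex.exp_conj]

theorem floquet_isHermitian {d : ℕ} {V : Type*} [AddAction (Fin d → ℤ) V] [DecidableEq V]
    {Γ : SimpleGraph V} {H : ℓ²(V, ℂ) →L[ℂ] ℓ²(V, ℂ)} (hH : IsPeriodicOperator (d := d) Γ H)
    (F : Finset V) (b : Module.Basis (Fin d) ℤ (Fin d → ℤ)) (α : Fin d → ℝ) :
    (floquet F b H α).IsHermitian := by
  ext u v
  simp only [floquet, Matrix.conjTranspose_apply, Matrix.of_apply]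
  have key : ∀ g : Fin d → ℤ, star (entry H (v : V) (g +ᵥ (u : V)) * character b α g)
      = entry H (u : V) (-g +ᵥ (v : V)) * character b α (-g) := by
    intro g
    rw [star_mul', entry_conj hH.self_adjoint, character_neg, ← hH.periodic (-g), neg_vadd_vadd]
  have hmap := AddEquiv.map_finsum (starAddEquiv : ℂ ≃+ ℂ)
    (fun g : Fin d → ℤ => entry H (v : V) (g +ᵥ (u : V)) * character b α g)
  simp only [starAddEquiv_apply] at hmap
  rw [hmap, finsum_congr key]
  exact finsum_comp_equiv (Equiv.neg (Fin d → ℤ))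
    (f := fun g => entry H (u : V) (g +ᵥ (v : V)) * character b α g)

/-- The eigenvalues of a Hermitian matrix in increasing order, repeated according to multiplicity,
with indices starting from `0` (Mathlib's `eigenvalues₀` is in decreasing order). -/
def nthEigenvalue {ι : Type*} [Fintype ι] [DecidableEq ι] {A : Matrix ι ι ℂ}
    (hA : A.IsHermitian) (n : Fin (Fintype.card ι)) : ℝ :=
  hA.eigenvalues₀ (Fin.rev n)

/-- The band `λ_{n+1}(T(α))` (the index `n` starts from `0`). -/
def band {d : ℕ} {V : Type*} [AddAction (Fin d → ℤ) V] [DecidableEq V]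
    {Γ : SimpleGraph V} {H : ℓ²(V, ℂ) →L[ℂ] ℓ²(V, ℂ)} (hH : IsPeriodicOperator (d := d) Γ H)
    (F : Finset V) (b : Module.Basis (Fin d) ℤ (Fin d → ℤ)) (n : Fin (Fintype.card F))
    (α : Fin d → ℝ) : ℝ :=
  nthEigenvalue (floquet_isHermitian hH F b α) n

/-- The Moore--Penrose pseudoinverse of a Hermitian matrix, from an orthonormal eigenbasis: nonzero
eigenvalues are inverted and the eigenvalue `0` is kept (using `0⁻¹ = 0`). -/
def pinv {ι : Type*} [Fintype ι] [DecidableEq ι] {A : Matrix ι ι ℂ} (hA : A.IsHermitian) :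
    Matrix ι ι ℂ :=
  (hA.eigenvectorUnitary : Matrix ι ι ℂ)
    * Matrix.diagonal (fun k => (((hA.eigenvalues k)⁻¹ : ℝ) : ℂ))
    * (hA.eigenvectorUnitary : Matrix ι ι ℂ)ᴴ

theorem isHermitian_sub_real {ι : Type*} [DecidableEq ι] {A : Matrix ι ι ℂ}
    (hA : A.IsHermitian) (t : ℝ) : (A - (t : ℂ) • (1 : Matrix ι ι ℂ)).IsHermitian := by
  refine hA.sub ?_
  simp [Matrix.IsHermitian, Matrix.conjTranspose_smul]

/-- The partial derivative `∂φ/∂α_j`. -/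
def partialDeriv {d : ℕ} (j : Fin d) (φ : (Fin d → ℝ) → ℂ) (α : Fin d → ℝ) : ℂ :=
  lineDeriv ℝ φ α (Pi.single j 1)

/-- `B = D (T(α) f)` at `α = α₀`, for a family `T` of matrices and a vector `f`. -/
def matB {d : ℕ} {ι : Type*} [Fintype ι] (T : (Fin d → ℝ) → Matrix ι ι ℂ) (f : ι → ℂ)
    (α₀ : Fin d → ℝ) : Matrix ι (Fin d) ℂ :=
  Matrix.of fun u j => partialDeriv j (fun α => (T α *ᵥ f) u) α₀

/-- `Ω = ½ Hess ⟨f, T(α) f⟩` at `α = α₀`. -/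
def matOmega {d : ℕ} {ι : Type*} [Fintype ι] (T : (Fin d → ℝ) → Matrix ι ι ℂ) (f : ι → ℂ)
    (α₀ : Fin d → ℝ) : Matrix (Fin d) (Fin d) ℂ :=
  Matrix.of fun j k =>
    (1 / 2 : ℂ) * partialDeriv j (partialDeriv k fun α => star f ⬝ᵥ (T α *ᵥ f)) α₀

/-- `W = Ω - B* (T(α₀) - t)⁺ B`, for a family `T` of Hermitian matrices, a real number `t` and a
vector `f`. -/
def matW {d : ℕ} {ι : Type*} [Fintype ι] [DecidableEq ι] {T : (Fin d → ℝ) → Matrix ι ι ℂ}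
    (hT : ∀ α, (T α).IsHermitian) (f : ι → ℂ) (t : ℝ) (α₀ : Fin d → ℝ) :
    Matrix (Fin d) (Fin d) ℂ :=
  matOmega T f α₀ - (matB T f α₀)ᴴ * pinv (isHermitian_sub_real (hT α₀) t) * matB T f α₀

end FloquetBloch

end

noncomputable section

namespace FloquetBloch

open Matrix Filter Topology

/-! ### Eigenvalue comparison and the pseudoinverse for Hermitian matrices. -/

section Spectral

variable {ι : Type*} [Fintype ι] [DecidableEq ι] {A B : Matrix ι ι ℂ}

/-! The `2d` crossing pairs form `d` edges and their reversals, and `T(α)` depends on `α` only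
through the phases of these `d` edges. By connectedness the `d` edge shifts are linearly
independent, so the edges can be treated as independent coordinates, even over `ℂ`.

Criticality and Hellmann–Feynman give `f* B = 0`; read edge by edge, this says that every weight
`conj f_s · f_t · z_e`, with `z_e` the matrix element of the edge at `α₀`, is real. Orient each edge
so that `f_s ≠ 0`. Then the second-order expansion at `α₀` is exact after a substitution: for each
`α` there is a linear `Y` with `x* T(α) x = x* T(α₀) x + 2 Re x* B Y x + (Y x)* Ω (Y x)` for all `x`
(`edge_identity`, `exists_linearMap_form_eq`). Completing the square turns the form of `T(α) - λ`
into the form of `T(α₀) - λ` at `L x` plus the form of `W` at `Y x`, where `L = 1 + (T(α₀) - λ)⁺ B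
Y` (`exists_form_sub_eq_form_add_matW`).

If `W` has a sign, one form therefore dominates a linear pullback of the other, and a min-max
dimension count compares the `n`-th eigenvalues even when `L` is not injective
(`nthEigenvalue_le_of_form_le`, `nthEigenvalue_le_of_le_form`). -/

theorem star_eigenvectorUnitary_mul_self (hA : A.IsHermitian) :
    (hA.eigenvectorUnitary : Matrix ι ι ℂ)ᴴ * (hA.eigenvectorUnitary : Matrix ι ι ℂ) = 1 := by
  simpa [star_eq_conjTranspose] using Unitary.coe_star_mul_self hA.eigenvectorUnitary

theorem eigenvectorUnitary_mul_star_self (hA : A.IsHermitian) :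
    (hA.eigenvectorUnitary : Matrix ι ι ℂ) * (hA.eigenvectorUnitary : Matrix ι ι ℂ)ᴴ = 1 := by
  simpa [star_eq_conjTranspose] using Unitary.coe_mul_star_self hA.eigenvectorUnitary

theorem eq_unitary_mul_diagonal_mul_star (hA : A.IsHermitian) :
    A = (hA.eigenvectorUnitary : Matrix ι ι ℂ) * diagonal (fun k => ((hA.eigenvalues k : ℝ) : ℂ))
      * (hA.eigenvectorUnitary : Matrix ι ι ℂ)ᴴ := by
  conv_lhs => rw [hA.spectral_theorem]
  simp [Unitary.conjStarAlgAut_apply, star_eq_conjTranspose]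
  rfl

/-- The coordinates of a vector in the eigenbasis of a Hermitian matrix. -/
def eigenCoord (hA : A.IsHermitian) (x : ι → ℂ) : ι → ℂ :=
  (hA.eigenvectorUnitary : Matrix ι ι ℂ)ᴴ *ᵥ x

theorem re_form_sub_eq_sum (hA : A.IsHermitian) (μ : ℝ) (x : ι → ℂ) :
    (star x ⬝ᵥ (A *ᵥ x)).re - μ * (star x ⬝ᵥ x).re
      = ∑ k, (hA.eigenvalues k - μ) * Complex.normSq (eigenCoord hA x k) := by
  have h1 : star x ⬝ᵥ (A *ᵥ x)
      = star (eigenCoord hA x) ⬝ᵥ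
        (diagonal (fun k => ((hA.eigenvalues k : ℝ) : ℂ)) *ᵥ eigenCoord hA x) := by
    conv_lhs => rw [eq_unitary_mul_diagonal_mul_star hA]
    simp only [eigenCoord, star_mulVec, conjTranspose_conjTranspose, ← mulVec_mulVec,
      dotProduct_mulVec]
  have h2 : star x ⬝ᵥ x = star (eigenCoord hA x) ⬝ᵥ eigenCoord hA x := by
    rw [eigenCoord, star_mulVec, conjTranspose_conjTranspose, ← dotProduct_mulVec, mulVec_mulVec,
      eigenvectorUnitary_mul_star_self, one_mulVec]
  rw [h1, h2]
  simp only [dotProduct, Pi.star_apply, mulVec_diagonal, Complex.re_sum, Finset.mul_sum,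
    ← Finset.sum_sub_distrib]
  refine Finset.sum_congr rfl fun k _ => ?_
  simp [Complex.normSq_apply]
  ring

theorem eigenCoord_ne_zero (hA : A.IsHermitian) {x : ι → ℂ} (hx : x ≠ 0) :
    ∃ k, eigenCoord hA x k ≠ 0 := by
  by_contra! h
  apply hx
  have h0 : eigenCoord hA x = 0 := funext h
  have := congrArg (fun y => (hA.eigenvectorUnitary : Matrix ι ι ℂ) *ᵥ y) h0
  simpa [eigenCoord, mulVec_mulVec, eigenvectorUnitary_mul_star_self] using this

/-- A dimension count: a nonzero vector in the span of the eigenvectors of `B` with index in `J`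
whose image under `L` is orthogonal to the eigenvectors of `A` with index in `I`. -/
theorem exists_ne_zero_eigenCoord_eq_zero (hA : A.IsHermitian) (hB : B.IsHermitian)
    (L : (ι → ℂ) →ₗ[ℂ] (ι → ℂ)) (I J : Finset ι) (hIJ : I.card < J.card) :
    ∃ x : ι → ℂ, x ≠ 0 ∧ (∀ k ∉ J, eigenCoord hB x k = 0) ∧
      ∀ k ∈ I, eigenCoord hA (L x) k = 0 := by
  let Φ : (ι → ℂ) →ₗ[ℂ] ((Jᶜ : Finset ι) → ℂ) × (I → ℂ) :=
    ((LinearMap.funLeft ℂ ℂ (fun k : (Jᶜ : Finset ι) => (k : ι))) ∘ₗ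
        (hB.eigenvectorUnitary : Matrix ι ι ℂ)ᴴ.mulVecLin).prod
      ((LinearMap.funLeft ℂ ℂ (fun k : I => (k : ι))) ∘ₗ
        (hA.eigenvectorUnitary : Matrix ι ι ℂ)ᴴ.mulVecLin ∘ₗ L)
  have hlt : Module.finrank ℂ (((Jᶜ : Finset ι) → ℂ) × (I → ℂ)) < Module.finrank ℂ (ι → ℂ) := by
    rw [Module.finrank_prod, Module.finrank_fintype_fun_eq_card, Module.finrank_fintype_fun_eq_card,
      Module.finrank_fintype_fun_eq_card, Fintype.card_coe, Fintype.card_coe, Finset.card_compl]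
    have := Finset.card_le_univ J
    omega
  obtain ⟨x, hx, hx0⟩ :=
    (Submodule.ne_bot_iff _).1 (LinearMap.ker_ne_bot_of_finrank_lt (f := Φ) hlt)
  have h : Φ x = 0 := hx
  refine ⟨x, hx0, fun k hk => ?_, fun k hk => ?_⟩
  · exact congrFun (congrArg Prod.fst h) ⟨k, Finset.mem_compl.2 hk⟩
  · exact congrFun (congrArg Prod.snd h) ⟨k, hk⟩

/-- The indexing of `Matrix.IsHermitian.eigenvalues`. -/
def eigenIndex (ι : Type*) [Fintype ι] : ι ≃ Fin (Fintype.card ι) :=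
  (Fintype.equivOfCardEq (Fintype.card_fin _)).symm

theorem eigenvalues_eq_eigenIndex (hA : A.IsHermitian) (k : ι) :
    hA.eigenvalues k = hA.eigenvalues₀ (eigenIndex ι k) := rfl

theorem card_filter_eigenIndex {ι : Type*} [Fintype ι] (p : Fin (Fintype.card ι) → Prop)
    [DecidablePred p] :
    (Finset.univ.filter fun k : ι => p (eigenIndex ι k)).card = (Finset.univ.filter p).card := by
  rw [← Finset.card_map (eigenIndex ι).toEmbedding]
  congr 1
  ext m
  simp only [Finset.mem_map_equiv, Finset.mem_filter, Finset.mem_univ, true_and,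
    Equiv.apply_symm_apply]

/-- If the form of `B - μ` dominates a pullback of the form of `A - μ`, where `μ` is the `n`-th
eigenvalue of `A`, then the `n`-th eigenvalue of `B` is at least `μ`. -/
theorem nthEigenvalue_le_of_form_le (hA : A.IsHermitian) (hB : B.IsHermitian)
    (n : Fin (Fintype.card ι)) (L : (ι → ℂ) →ₗ[ℂ] (ι → ℂ))
    (h : ∀ x, (star (L x) ⬝ᵥ (A *ᵥ L x)).re - nthEigenvalue hA n * (star (L x) ⬝ᵥ L x).re
      ≤ (star x ⬝ᵥ (B *ᵥ x)).re - nthEigenvalue hA n * (star x ⬝ᵥ x).re) :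
    nthEigenvalue hA n ≤ nthEigenvalue hB n := by
  set μ := nthEigenvalue hA n with hμ
  by_contra! hlt
  -- `eigenvalues₀` decreases: `J` carries eigenvalues of `B` that are at most its `n`-th, and `I`
  -- the positions strictly below the `n`-th of `A`. `J` has exactly one index more than `I`, namely
  -- that of `n.rev`.
  obtain ⟨x, hx, hxJ, hxI⟩ := exists_ne_zero_eigenCoord_eq_zero hA hB L
    (Finset.univ.filter fun k => n.rev < eigenIndex ι k)
    (Finset.univ.filter fun k => n.rev ≤ eigenIndex ι k) (by
      rw [card_filter_eigenIndex (fun m => n.rev < m), card_filter_eigenIndex (fun m => n.rev ≤ m)]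
      refine Finset.card_lt_card ⟨fun m => by simpa using le_of_lt, fun hs => ?_⟩
      simpa using hs (by simp : n.rev ∈ _))
  specialize h x
  rw [re_form_sub_eq_sum hA, re_form_sub_eq_sum hB] at h
  have h1 : 0 ≤ ∑ k, (hA.eigenvalues k - μ) * Complex.normSq (eigenCoord hA (L x) k) := by
    refine Finset.sum_nonneg fun k _ => ?_
    by_cases hk : n.rev < eigenIndex ι k
    · simp [hxI k (by simpa using hk)]
    · exact mul_nonneg (sub_nonneg.2 (hA.eigenvalues₀_antitone (not_lt.1 hk)))
        (Complex.normSq_nonneg _)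
  have hle : ∀ k, (hB.eigenvalues k - μ) * Complex.normSq (eigenCoord hB x k) ≤ 0 ∧
      (eigenCoord hB x k ≠ 0 →
        (hB.eigenvalues k - μ) * Complex.normSq (eigenCoord hB x k) < 0) := by
    intro k
    by_cases hk : n.rev ≤ eigenIndex ι k
    · have : hB.eigenvalues k - μ < 0 :=
        sub_neg.2 ((hB.eigenvalues₀_antitone hk).trans_lt hlt)
      exact ⟨mul_nonpos_of_nonpos_of_nonneg this.le (Complex.normSq_nonneg _),
        fun hne => mul_neg_of_neg_of_pos this (Complex.normSq_pos.2 hne)⟩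
    · simp [hxJ k (by simpa using hk)]
  -- Strictness comes from `x ≠ 0` on the side of `B`, so `L x = 0` does no harm.
  obtain ⟨k, hk⟩ := eigenCoord_ne_zero hB hx
  exact absurd (h1.trans h) (not_le.2
    (Finset.sum_neg' (fun k _ => (hle k).1) ⟨k, Finset.mem_univ _, (hle k).2 hk⟩))

/-- If the form of `B - μ` is dominated by a pullback of the form of `A - μ`, where `μ` is the
`n`-th eigenvalue of `A`, then the `n`-th eigenvalue of `B` is at most `μ`. -/
theorem nthEigenvalue_le_of_le_form (hA : A.IsHermitian) (hB : B.IsHermitian)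
    (n : Fin (Fintype.card ι)) (L : (ι → ℂ) →ₗ[ℂ] (ι → ℂ))
    (h : ∀ x, (star x ⬝ᵥ (B *ᵥ x)).re - nthEigenvalue hA n * (star x ⬝ᵥ x).re ≤
      (star (L x) ⬝ᵥ (A *ᵥ L x)).re - nthEigenvalue hA n * (star (L x) ⬝ᵥ L x).re) :
    nthEigenvalue hB n ≤ nthEigenvalue hA n := by
  set μ := nthEigenvalue hA n with hμ
  by_contra! hlt
  obtain ⟨x, hx, hxJ, hxI⟩ := exists_ne_zero_eigenCoord_eq_zero hA hB L
    (Finset.univ.filter fun k => eigenIndex ι k < n.rev)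
    (Finset.univ.filter fun k => eigenIndex ι k ≤ n.rev) (by
      rw [card_filter_eigenIndex (fun m => m < n.rev), card_filter_eigenIndex (fun m => m ≤ n.rev)]
      refine Finset.card_lt_card ⟨fun m => by simpa using le_of_lt, fun hs => ?_⟩
      simpa using hs (by simp : n.rev ∈ _))
  specialize h x
  rw [re_form_sub_eq_sum hA, re_form_sub_eq_sum hB] at h
  have h1 : ∑ k, (hA.eigenvalues k - μ) * Complex.normSq (eigenCoord hA (L x) k) ≤ 0 := by
    refine Finset.sum_nonpos fun k _ => ?_
    by_cases hk : eigenIndex ι k < n.rev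
    · simp [hxI k (by simpa using hk)]
    · exact mul_nonpos_of_nonpos_of_nonneg
        (sub_nonpos.2 (hA.eigenvalues₀_antitone (not_lt.1 hk))) (Complex.normSq_nonneg _)
  have hle : ∀ k, 0 ≤ (hB.eigenvalues k - μ) * Complex.normSq (eigenCoord hB x k) ∧
      (eigenCoord hB x k ≠ 0 →
        0 < (hB.eigenvalues k - μ) * Complex.normSq (eigenCoord hB x k)) := by
    intro k
    by_cases hk : eigenIndex ι k ≤ n.rev
    · have : 0 < hB.eigenvalues k - μ :=
        sub_pos.2 (hlt.trans_le (hB.eigenvalues₀_antitone hk))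
      exact ⟨mul_nonneg this.le (Complex.normSq_nonneg _),
        fun hne => mul_pos this (Complex.normSq_pos.2 hne)⟩
    · simp [hxJ k (by simpa using hk)]
  obtain ⟨k, hk⟩ := eigenCoord_ne_zero hB hx
  exact absurd (h.trans h1) (not_le.2
    (Finset.sum_pos' (fun k _ => (hle k).1) ⟨k, Finset.mem_univ _, (hle k).2 hk⟩))

theorem exists_mulVec_eq_nthEigenvalue_smul (hA : A.IsHermitian) (n : Fin (Fintype.card ι)) :
    ∃ x : ι → ℂ, x ≠ 0 ∧ A *ᵥ x = (nthEigenvalue hA n : ℂ) • x := by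
  refine ⟨⇑(hA.eigenvectorBasis ((eigenIndex ι).symm n.rev)), fun h => ?_, ?_⟩
  · exact hA.eigenvectorBasis.toBasis.ne_zero ((eigenIndex ι).symm n.rev) (by
      ext i; simpa using congrFun h i)
  · rw [hA.mulVec_eigenvectorBasis, eigenvalues_eq_eigenIndex, Equiv.apply_symm_apply]
    rfl

/-- `A A⁺` fixes the vectors orthogonal to the kernel of `A`. -/
theorem mul_pinv_mulVec (hA : A.IsHermitian) {v : ι → ℂ}
    (hv : ∀ x : ι → ℂ, A *ᵥ x = 0 → star x ⬝ᵥ v = 0) : A *ᵥ (pinv hA *ᵥ v) = v := by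
  set U : Matrix ι ι ℂ := (hA.eigenvectorUnitary : Matrix ι ι ℂ) with hU
  have key : diagonal (fun k => ((hA.eigenvalues k : ℝ) : ℂ)) *ᵥ
      (diagonal (fun k => (((hA.eigenvalues k)⁻¹ : ℝ) : ℂ)) *ᵥ (Uᴴ *ᵥ v)) = Uᴴ *ᵥ v := by
    ext k
    rw [mulVec_diagonal, mulVec_diagonal]
    -- Here `0⁻¹ = 0` makes the left side vanish; the right side vanishes because `v` is orthogonal
    -- to this null eigenvector.
    by_cases hk : hA.eigenvalues k = 0
    · have h0 : A *ᵥ ⇑(hA.eigenvectorBasis k) = 0 := by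
        rw [hA.mulVec_eigenvectorBasis, hk, zero_smul]
      have : (Uᴴ *ᵥ v) k = star (⇑(hA.eigenvectorBasis k)) ⬝ᵥ v := by
        simp [mulVec, dotProduct, hU]
      rw [this, hv _ h0]
      simp
    · rw [← mul_assoc, ← Complex.ofReal_mul, mul_inv_cancel₀ hk, Complex.ofReal_one, one_mul]
  calc A *ᵥ (pinv hA *ᵥ v)
      = U *ᵥ (diagonal (fun k => ((hA.eigenvalues k : ℝ) : ℂ)) *ᵥ ((Uᴴ * U) *ᵥ
          (diagonal (fun k => (((hA.eigenvalues k)⁻¹ : ℝ) : ℂ)) *ᵥ (Uᴴ *ᵥ v)))) := by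
        conv_lhs => enter [1]; rw [eq_unitary_mul_diagonal_mul_star hA]
        simp only [pinv, mulVec_mulVec, Matrix.mul_assoc, hU]
    _ = v := by
        rw [star_eigenvectorUnitary_mul_self, one_mulVec, key, mulVec_mulVec,
          eigenvectorUnitary_mul_star_self, one_mulVec]

end Spectral

/-! ### First-order perturbation of a simple eigenvalue. -/

section HellmannFeynman

variable {ι : Type*} [Fintype ι]

/-- The Hellmann--Feynman formula: at a simple eigenvalue, a differentiable branch of eigenvalues
has derivative `⟨f, T' f⟩`, where `f` is the normalized eigenvector. -/
theorem hellmannFeynman {T : ℝ → Matrix ι ι ℂ} {T' : Matrix ι ι ℂ} {lam : ℝ → ℝ} {lam' : ℝ}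
    (hherm : (T 0).IsHermitian)
    (hT : ∀ u v, HasDerivAt (fun t => T t u v) (T' u v) 0) (hlam : HasDerivAt lam lam' 0)
    (heig : ∀ t, ∃ x : ι → ℂ, x ≠ 0 ∧ T t *ᵥ x = (lam t : ℂ) • x) {f : ι → ℂ}
    (hf : T 0 *ᵥ f = (lam 0 : ℂ) • f) (hnorm : star f ⬝ᵥ f = 1)
    (hsimple : ∀ x : ι → ℂ, T 0 *ᵥ x = (lam 0 : ℂ) • x → ∃ c : ℂ, x = c • f) :
    star f ⬝ᵥ (T' *ᵥ f) = lam' := by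
  have hunit : ∀ t, ∃ x : ι → ℂ, ‖x‖ = 1 ∧ T t *ᵥ x = (lam t : ℂ) • x := by
    intro t
    obtain ⟨x, hx, h⟩ := heig t
    refine ⟨((‖x‖⁻¹ : ℝ) : ℂ) • x, ?_, ?_⟩
    · rw [norm_smul, Complex.norm_real, norm_inv, norm_norm, inv_mul_cancel₀ (norm_ne_zero_iff.2 hx)]
    · rw [mulVec_smul, h, smul_comm]
  choose x hx hTx using hunit
  -- The unit eigenvectors `x t` need not depend continuously on `t`. Compactness of the sphere
  -- gives a limit along an ultrafilter, and simplicity forces this limit to be `c • f` with `c ≠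
  -- 0`.
  let U : Ultrafilter ℝ := Ultrafilter.of (𝓝[≠] 0)
  have hU : (U : Filter ℝ) ≤ 𝓝[≠] 0 := Ultrafilter.of_le _
  obtain ⟨g, hg, hlim⟩ := (isCompact_sphere (0 : ι → ℂ) 1).ultrafilter_le_nhds' (U.map x)
    (Ultrafilter.mem_map.2 (Filter.univ_mem' fun t => by simp [hx t]))
  have hlim : Tendsto x U (𝓝 g) := hlim
  have hU0 : (U : Filter ℝ) ≤ 𝓝 0 := hU.trans nhdsWithin_le_nhds
  have hlamc : Tendsto (fun t => (lam t : ℂ)) U (𝓝 (lam 0 : ℂ)) :=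
    (Complex.continuous_ofReal.tendsto _).comp (hlam.continuousAt.tendsto.mono_left hU0)
  have hTc : Tendsto T U (𝓝 (T 0)) :=
    tendsto_pi_nhds.2 fun u => tendsto_pi_nhds.2 fun v =>
      (hT u v).continuousAt.tendsto.mono_left hU0
  have hmv : Continuous fun p : Matrix ι ι ℂ × (ι → ℂ) => p.1 *ᵥ p.2 :=
    continuous_fst.matrix_mulVec continuous_snd
  have hdot : Continuous fun y : ι → ℂ => star f ⬝ᵥ y := continuous_const.dotProduct continuous_id
  have hg_eig : T 0 *ᵥ g = (lam 0 : ℂ) • g :=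
    tendsto_nhds_unique ((hmv.tendsto (T 0, g)).comp (hTc.prodMk_nhds hlim))
      ((hlamc.smul hlim).congr fun t => (hTx t).symm)
  obtain ⟨c, rfl⟩ := hsimple g hg_eig
  have hc : c ≠ 0 := by
    rintro rfl
    simp at hg
  have hquot : Tendsto (fun t : ℝ => Matrix.of fun u v => (t : ℂ)⁻¹ * (T t u v - T 0 u v)) U
      (𝓝 T') := by
    refine tendsto_pi_nhds.2 fun u => tendsto_pi_nhds.2 fun v => ?_
    have := ((hasDerivAt_iff_tendsto_slope_zero.1 (hT u v)).mono_left hU)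
    simpa [Complex.real_smul] using this
  have hlquot : Tendsto (fun t : ℝ => (t : ℂ)⁻¹ * ((lam t : ℂ) - lam 0)) U (𝓝 (lam' : ℂ)) := by
    have := (Complex.continuous_ofReal.tendsto _).comp
      ((hasDerivAt_iff_tendsto_slope_zero.1 hlam).mono_left hU)
    simpa [Function.comp_def] using this
  have hrow : star f ᵥ* T 0 = (lam 0 : ℂ) • star f := by
    have := congrArg star hf
    rw [star_mulVec, hherm.eq] at this
    simpa using this
  -- Since `star f` is a left eigenvector of `T 0`, no derivative of the eigenvectors is needed.
  have heq : ∀ t : ℝ, star f ⬝ᵥ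
      ((Matrix.of fun u v => (t : ℂ)⁻¹ * (T t u v - T 0 u v)) *ᵥ x t)
      = ((t : ℂ)⁻¹ * ((lam t : ℂ) - lam 0)) * (star f ⬝ᵥ x t) := by
    intro t
    have : (Matrix.of fun u v => (t : ℂ)⁻¹ * (T t u v - T 0 u v)) = (t : ℂ)⁻¹ • (T t - T 0) := by
      ext; simp
    rw [this, smul_mulVec, sub_mulVec, hTx, dotProduct_smul, dotProduct_sub, dotProduct_mulVec,
      hrow, dotProduct_smul, smul_dotProduct]
    simp only [smul_eq_mul]
    ring
  have hfin := tendsto_nhds_unique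
    ((hdot.tendsto _).comp ((hmv.tendsto (T', c • f)).comp (hquot.prodMk_nhds hlim)))
    ((hlquot.mul ((hdot.tendsto _).comp hlim)).congr fun t => (heq t).symm)
  simp only [mulVec_smul, dotProduct_smul, hnorm, smul_eq_mul, mul_one] at hfin
  rw [mul_comm] at hfin
  exact mul_right_cancel₀ hc hfin

end HellmannFeynman

/-! ### Matrix families driven by edge phases: expansion and completion of the square. -/

section EdgeFamily

variable {d : ℕ} {ι O : Type*} [DecidableEq ι]

/-- The matrix element `h_e exp (i ∑_j α_j a_{ej})` carried by the edge `e`. -/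
def edgePhase (h : O → ℂ) (a : O → Fin d → ℝ) (e : O) (α : Fin d → ℝ) : ℂ :=
  h e * Complex.exp (Complex.I * ∑ j, (α j : ℂ) * (a e j : ℂ))

/-- A Hermitian family in which `α` enters only through the phases of the edges `s e ∼ t e`. -/
def edgeFamily [Fintype O] (M : Matrix ι ι ℂ) (s t : O → ι) (h : O → ℂ) (a : O → Fin d → ℝ)
    (α : Fin d → ℝ) : Matrix ι ι ℂ :=
  M + ∑ e, (Matrix.single (s e) (t e) (edgePhase h a e α)
    + Matrix.single (t e) (s e) (star (edgePhase h a e α)))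

/-- The complex linear map `y ↦ (∑_j a_{ej} y_j)_e`. -/
def edgeMap (a : O → Fin d → ℝ) : (Fin d → ℂ) →ₗ[ℂ] (O → ℂ) :=
  (Matrix.of fun e j => (a e j : ℂ)).mulVecLin

theorem edgeMap_apply (a : O → Fin d → ℝ) (y : Fin d → ℂ) (e : O) :
    edgeMap a y e = ∑ j, (a e j : ℂ) * y j := rfl

theorem hasLineDerivAt_edgePhase (h : O → ℂ) (a : O → Fin d → ℝ) (e : O) (α : Fin d → ℝ) (j : Fin d) :
    HasLineDerivAt ℝ (edgePhase h a e) (Complex.I * a e j * edgePhase h a e α) α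
      (Pi.single j 1) := by
  have hfun : (fun τ : ℝ => edgePhase h a e (α + τ • Pi.single j 1))
      = fun τ : ℝ => edgePhase h a e α * Complex.exp (Complex.I * a e j * (τ : ℂ)) := by
    ext τ
    rw [edgePhase, edgePhase, mul_assoc, ← Complex.exp_add]
    congr 2
    have : ∑ k, (((α + τ • Pi.single j 1 : Fin d → ℝ) k : ℝ) : ℂ) * (a e k : ℂ)
        = ∑ k, (α k : ℂ) * (a e k : ℂ) + τ * a e j := by
      simp [add_mul, Finset.sum_add_distrib, Pi.single_apply, apply_ite Complex.ofReal, ite_mul]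
    rw [this]
    ring
  rw [HasLineDerivAt, hfun]
  have h1 : HasDerivAt (fun τ : ℝ => Complex.I * a e j * (τ : ℂ)) (Complex.I * a e j) 0 := by
    simpa using (Complex.ofRealCLM.hasDerivAt (x := (0 : ℝ))).const_mul (Complex.I * (a e j : ℂ))
  simpa [mul_comm, mul_left_comm] using (h1.cexp.const_mul (edgePhase h a e α))

variable [Fintype O] (M : Matrix ι ι ℂ) (s t : O → ι) (h : O → ℂ) (a : O → Fin d → ℝ)

theorem edgeFamily_apply (α : Fin d → ℝ) (u v : ι) :
    edgeFamily M s t h a α u v = M u v + ∑ e,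
      ((if s e = u ∧ t e = v then 1 else 0) * edgePhase h a e α
        + (if t e = u ∧ s e = v then 1 else 0) * star (edgePhase h a e α)) := by
  simp [edgeFamily, Matrix.sum_apply, Matrix.single_apply]

variable [Fintype ι]

theorem edgeFamily_mulVec (α : Fin d → ℝ) (y : ι → ℂ) (u : ι) :
    (edgeFamily M s t h a α *ᵥ y) u = (M *ᵥ y) u + ∑ e,
      ((Pi.single (s e) (y (t e)) : ι → ℂ) u * edgePhase h a e α
        + (Pi.single (t e) (y (s e)) : ι → ℂ) u * star (edgePhase h a e α)) := by
  simp only [edgeFamily, add_mulVec, sum_mulVec, Pi.add_apply, Finset.sum_apply]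
  congr 1
  refine Finset.sum_congr rfl fun e _ => ?_
  simp [Matrix.single_mulVec, Pi.single_apply, Function.update_apply, mul_comm]

theorem dotProduct_edgeFamily_mulVec (α : Fin d → ℝ) (x y : ι → ℂ) :
    star x ⬝ᵥ (edgeFamily M s t h a α *ᵥ y) = star x ⬝ᵥ (M *ᵥ y) + ∑ e,
      (star (x (s e)) * y (t e) * edgePhase h a e α
        + star (x (t e)) * y (s e) * star (edgePhase h a e α)) := by
  have : edgeFamily M s t h a α *ᵥ y = M *ᵥ y + ∑ e,
      (edgePhase h a e α • (Pi.single (s e) (y (t e)) : ι → ℂ)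
        + star (edgePhase h a e α) • (Pi.single (t e) (y (s e)) : ι → ℂ)) := by
    ext u
    rw [edgeFamily_mulVec]
    simp [Finset.sum_apply, mul_comm]
  rw [this, dotProduct_add, dotProduct_sum]
  simp [dotProduct_add, dotProduct_smul, mul_comm, mul_left_comm]

/-- The entries of `T(α)` and `T(α) f`, and the form `⟨f, T(α) f⟩`, all have this shape, and the
shape is stable under differentiation, so the same formula also serves for the Hessian. -/
theorem hasLineDerivAt_edgeSum (p : ℂ) (c c' : O → ℂ) (α : Fin d → ℝ) (j : Fin d) :
    HasLineDerivAt ℝ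
      (fun α => p + ∑ e, (c e * edgePhase h a e α + c' e * star (edgePhase h a e α)))
      (∑ e, (c e * (Complex.I * a e j) * edgePhase h a e α
        + c' e * -(Complex.I * a e j) * star (edgePhase h a e α))) α (Pi.single j 1) := by
  refine HasDerivAt.const_add p (HasDerivAt.fun_sum fun e _ => HasDerivAt.add ?_ ?_)
  · rw [mul_assoc]
    exact (hasLineDerivAt_edgePhase h a e α j).const_mul (c e)
  · have := ((hasLineDerivAt_edgePhase h a e α j).star).const_mul (c' e)
    have hz : star (Complex.I * a e j * edgePhase h a e α)
        = -(Complex.I * a e j) * star (edgePhase h a e α) := by simp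
    rw [mul_assoc, ← hz]
    exact this

theorem partialDeriv_edgeSum (p : ℂ) (c c' : O → ℂ) (j : Fin d) :
    partialDeriv j
      (fun α => p + ∑ e, (c e * edgePhase h a e α + c' e * star (edgePhase h a e α)))
      = fun α => ∑ e, (c e * (Complex.I * a e j) * edgePhase h a e α
        + c' e * -(Complex.I * a e j) * star (edgePhase h a e α)) :=
  funext fun α => (hasLineDerivAt_edgeSum h a p c c' α j).lineDeriv

/-- A direction `y` enters only through its edge coordinates, so the form splits into one term per
edge; the same holds for `Ω` below. -/
theorem dotProduct_matB_mulVec (f : ι → ℂ) (α : Fin d → ℝ) (x : ι → ℂ) (y : Fin d → ℂ) :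
    star x ⬝ᵥ (matB (edgeFamily M s t h a) f α *ᵥ y) = ∑ e, Complex.I * edgeMap a y e *
      (star (x (s e)) * f (t e) * edgePhase h a e α
        - star (x (t e)) * f (s e) * star (edgePhase h a e α)) := by
  have hB : ∀ j, (matB (edgeFamily M s t h a) f α).col j = ∑ e, (Complex.I * a e j) •
      (edgePhase h a e α • (Pi.single (s e) (f (t e)) : ι → ℂ)
        - star (edgePhase h a e α) • (Pi.single (t e) (f (s e)) : ι → ℂ)) := by
    intro j
    ext u
    simp only [Matrix.col_apply, matB, of_apply, edgeFamily_mulVec, partialDeriv_edgeSum,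
      Finset.sum_apply, Pi.smul_apply, Pi.sub_apply, smul_eq_mul]
    exact Finset.sum_congr rfl fun e _ => by ring
  have hy : matB (edgeFamily M s t h a) f α *ᵥ y
      = ∑ j, y j • (matB (edgeFamily M s t h a) f α).col j := by
    ext u
    simp [mulVec, dotProduct, Finset.sum_apply, mul_comm]
  rw [hy]
  simp only [hB, dotProduct_sum, dotProduct_smul, dotProduct_sub, dotProduct_single, smul_eq_mul,
    edgeMap_apply, Pi.star_apply, Finset.mul_sum, Finset.sum_mul]
  rw [Finset.sum_comm]
  exact Finset.sum_congr rfl fun e _ => Finset.sum_congr rfl fun j _ => by ring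

theorem dotProduct_matOmega_mulVec (f : ι → ℂ) (α : Fin d → ℝ) (y : Fin d → ℂ) :
    star y ⬝ᵥ (matOmega (edgeFamily M s t h a) f α *ᵥ y) = ∑ e, -(1 / 2 : ℂ) *
      (star (edgeMap a y e) * edgeMap a y e) *
      (star (f (s e)) * f (t e) * edgePhase h a e α
        + star (f (t e)) * f (s e) * star (edgePhase h a e α)) := by
  have hΩ : ∀ j k, matOmega (edgeFamily M s t h a) f α j k = ∑ e, -(1 / 2 : ℂ) * a e j * a e k *
      (star (f (s e)) * f (t e) * edgePhase h a e α
        + star (f (t e)) * f (s e) * star (edgePhase h a e α)) := by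
    intro j k
    have h0 := partialDeriv_edgeSum h a 0
      (fun e => star (f (s e)) * f (t e) * (Complex.I * a e k))
      (fun e => star (f (t e)) * f (s e) * -(Complex.I * a e k)) j
    simp only [zero_add] at h0
    simp only [matOmega, of_apply, dotProduct_edgeFamily_mulVec, partialDeriv_edgeSum, h0,
      Finset.mul_sum]
    refine Finset.sum_congr rfl fun e _ => ?_
    linear_combination (1 / 2 : ℂ) * a e j * a e k * (star (f (s e)) * f (t e) * edgePhase h a e α
        + star (f (t e)) * f (s e) * star (edgePhase h a e α)) * Complex.I_mul_I
  calc star y ⬝ᵥ (matOmega (edgeFamily M s t h a) f α *ᵥ y)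
      = ∑ j, ∑ k, ∑ e, -(1 / 2 : ℂ) * ((a e j * star (y j)) * (a e k * y k)) *
          (star (f (s e)) * f (t e) * edgePhase h a e α
            + star (f (t e)) * f (s e) * star (edgePhase h a e α)) := by
        simp only [dotProduct, mulVec, hΩ, Finset.mul_sum, Finset.sum_mul, Pi.star_apply]
        exact Finset.sum_congr rfl fun j _ => Finset.sum_congr rfl fun k _ =>
          Finset.sum_congr rfl fun e _ => by ring
    _ = _ := by
        refine (Finset.sum_congr rfl fun j _ => Finset.sum_comm).trans
          (Finset.sum_comm.trans (Finset.sum_congr rfl fun e _ => ?_))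
        have hs : star (edgeMap a y e) = ∑ j, (a e j : ℂ) * star (y j) := by
          simp [edgeMap_apply]
        rw [hs, edgeMap_apply, Finset.sum_mul_sum]
        simp only [Finset.mul_sum, Finset.sum_mul]

theorem edgePhase_eq_mul {O : Type*} (h : O → ℂ) (a : O → Fin d → ℝ) (e : O) (α β : Fin d → ℝ) :
    ∃ ω : ℂ, ω * star ω = 1 ∧ edgePhase h a e α = edgePhase h a e β * ω := by
  set θ : ℝ := ∑ j, α j * a e j - ∑ j, β j * a e j with hθ
  refine ⟨Complex.exp (Complex.I * θ), ?_, ?_⟩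
  · rw [RCLike.star_def, ← Complex.exp_conj, ← Complex.exp_add]
    simp
  · rw [edgePhase, edgePhase, mul_assoc, ← Complex.exp_add]
    congr 2
    simp only [hθ]
    push_cast
    ring

/-- The contribution of one edge to the form of `T(α) - T(β)`, expressed by the edge variable
`η = i (ω̄ - 1) p / f` at the phase `β`. -/
theorem edge_identity {z ω f g p q : ℂ} (hω : ω * star ω = 1) (hf : f ≠ 0)
    (hreal : star f * g * z = star g * f * star z) :
    (star p * q * (z * ω) + star q * p * star (z * ω))
        - (star p * q * z + star q * p * star z)
      = Complex.I * (Complex.I * (star ω - 1) / f * p) * (star p * g * z - star q * f * star z)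
        + star (Complex.I * (Complex.I * (star ω - 1) / f * p)
          * (star p * g * z - star q * f * star z))
        + -(1 / 2 : ℂ) * (star (Complex.I * (star ω - 1) / f * p)
          * (Complex.I * (star ω - 1) / f * p)) *
          (star f * g * z + star g * f * star z) := by
  have hf' : star f ≠ 0 := star_ne_zero.2 hf
  simp only [star_mul', star_sub, star_div₀, star_star, star_one]
  have hI : star Complex.I = -Complex.I := Complex.conj_I
  rw [hI]
  field_simp
  rw [Complex.I_sq]
  -- The choice of `η` makes the terms containing `q` agree exactly. What remains is a multiple of
  -- `|p|²`, and it cancels because the weight is real and `|ω - 1|² = 2 (1 - Re ω)` when `|ω| = 1`.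
  linear_combination p * star p * (star f * g * z + star g * f * star z) * hω
    + p * star p * (star ω - ω) * hreal

/-- If `B` is orthogonal to `f`, then the weights `conj f_s f_t h_e exp (i ∑_j α_j a_{ej})` of the
edges are real. -/
theorem edge_weight_real_of_orthogonal
    (ha : Function.Bijective (edgeMap a)) {f : ι → ℂ} {α : Fin d → ℝ}
    (hB : ∀ y, star f ⬝ᵥ (matB (edgeFamily M s t h a) f α *ᵥ y) = 0) [DecidableEq O] (e : O) :
    star (f (s e)) * f (t e) * edgePhase h a e α
      = star (f (t e)) * f (s e) * star (edgePhase h a e α) := by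
  obtain ⟨y, hy⟩ := ha.2 (Pi.single e 1)
  have := hB y
  rw [dotProduct_matB_mulVec, hy, Finset.sum_eq_single e] at this
  · simpa [sub_eq_zero] using this
  · intro e' _ he'
    simp [he']
  · simp

variable {M s t h a}

/-- The form of `T(α)` is that of `T(α₀)`, plus the second order expansion at `α₀` evaluated at a
vector of the complexified quasimomentum space depending linearly on the argument. -/
theorem exists_linearMap_form_eq (ha : Function.Bijective (edgeMap a)) {f : ι → ℂ}
    {α₀ : Fin d → ℝ} (hB : ∀ y, star f ⬝ᵥ (matB (edgeFamily M s t h a) f α₀ *ᵥ y) = 0)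
    (hfs : ∀ e, f (s e) ≠ 0) (α : Fin d → ℝ) :
    ∃ Y : (ι → ℂ) →ₗ[ℂ] (Fin d → ℂ), ∀ x,
      star x ⬝ᵥ (edgeFamily M s t h a α *ᵥ x) = star x ⬝ᵥ (edgeFamily M s t h a α₀ *ᵥ x)
        + star x ⬝ᵥ (matB (edgeFamily M s t h a) f α₀ *ᵥ Y x)
        + star (star x ⬝ᵥ (matB (edgeFamily M s t h a) f α₀ *ᵥ Y x))
        + star (Y x) ⬝ᵥ (matOmega (edgeFamily M s t h a) f α₀ *ᵥ Y x) := by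
  classical
  choose ω hω hphase using fun e => edgePhase_eq_mul h a e α α₀
  -- These are the edge variables `η` of `edge_identity`; inverting the edge map realises them by a
  -- complex vector `Y x`.
  let D : (ι → ℂ) →ₗ[ℂ] (O → ℂ) := LinearMap.pi fun e =>
    (Complex.I * (star (ω e) - 1) / f (s e)) • LinearMap.proj (s e)
  refine ⟨(LinearEquiv.ofBijective (edgeMap a) ha).symm.toLinearMap ∘ₗ D, fun x => ?_⟩
  set y := ((LinearEquiv.ofBijective (edgeMap a) ha).symm.toLinearMap ∘ₗ D) x with hy
  have hay : ∀ e, edgeMap a y e = Complex.I * (star (ω e) - 1) / f (s e) * x (s e) := by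
    intro e
    have : edgeMap a y = D x := (LinearEquiv.ofBijective (edgeMap a) ha).apply_symm_apply (D x)
    rw [this]
    simp [D]
  rw [dotProduct_edgeFamily_mulVec, dotProduct_edgeFamily_mulVec, dotProduct_matB_mulVec,
    dotProduct_matOmega_mulVec, star_sum, add_assoc, add_assoc, add_assoc, add_right_inj,
    ← sub_eq_iff_eq_add', ← Finset.sum_sub_distrib, ← Finset.sum_add_distrib,
    ← Finset.sum_add_distrib]
  refine Finset.sum_congr rfl fun e _ => ?_
  rw [hay, hphase, edge_identity (hω e) (hfs e)
    (edge_weight_real_of_orthogonal M s t h a ha hB e), add_assoc]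

/-- Completing the square: the form of `T(α) - λ` is a pullback of the form of `T(α₀) - λ` plus a
pullback of the form of `W`. -/
theorem exists_form_sub_eq_form_add_matW {T : (Fin d → ℝ) → Matrix ι ι ℂ}
    (hT : ∀ α, (T α).IsHermitian) (hTe : T = edgeFamily M s t h a)
    (ha : Function.Bijective (edgeMap a)) {f : ι → ℂ} {α₀ : Fin d → ℝ} {μ : ℝ}
    (hB : ∀ y, star f ⬝ᵥ (matB T f α₀ *ᵥ y) = 0) (hfs : ∀ e, f (s e) ≠ 0)
    (hsimple : ∀ x : ι → ℂ, T α₀ *ᵥ x = (μ : ℂ) • x → ∃ c : ℂ, x = c • f) (α : Fin d → ℝ) :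
    ∃ (L : (ι → ℂ) →ₗ[ℂ] (ι → ℂ)) (Y : (ι → ℂ) →ₗ[ℂ] (Fin d → ℂ)), ∀ x,
      (star x ⬝ᵥ (T α *ᵥ x)).re - μ * (star x ⬝ᵥ x).re
        = (star (L x) ⬝ᵥ (T α₀ *ᵥ L x)).re - μ * (star (L x) ⬝ᵥ L x).re
          + (star (Y x) ⬝ᵥ (matW hT f μ α₀ *ᵥ Y x)).re := by
  subst hTe
  obtain ⟨Y, hY⟩ := exists_linearMap_form_eq ha hB hfs α
  set T := edgeFamily M s t h a with hTdef
  set B := matB T f α₀ with hBdef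
  set P := pinv (isHermitian_sub_real (hT α₀) μ) with hP
  set A := T α₀ - (μ : ℂ) • (1 : Matrix ι ι ℂ) with hA
  -- The shift `P B Y x` absorbs the cross terms, at the cost of `-(B Y x)* P (B Y x)`, the
  -- correction contained in `W`.
  refine ⟨LinearMap.id + P.mulVecLin ∘ₗ B.mulVecLin ∘ₗ Y, Y, fun x => ?_⟩
  set y := Y x with hy
  have hAx : ∀ (α : Fin d → ℝ) (v : ι → ℂ), (star v ⬝ᵥ (T α *ᵥ v)).re - μ * (star v ⬝ᵥ v).re
      = (star v ⬝ᵥ (T α *ᵥ v) - (μ : ℂ) * (star v ⬝ᵥ v)).re := by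
    intro α v
    simp
  have hAv : ∀ v : ι → ℂ, star v ⬝ᵥ (T α₀ *ᵥ v) - (μ : ℂ) * (star v ⬝ᵥ v)
      = star v ⬝ᵥ (A *ᵥ v) := by
    intro v
    simp [hA, sub_mulVec, smul_mulVec, dotProduct_sub]
  -- By simplicity the kernel of `A` lies in the line of `f`, to which the range of `B` is
  -- orthogonal.
  have hAP : A *ᵥ (P *ᵥ (B *ᵥ y)) = B *ᵥ y := by
    refine mul_pinv_mulVec _ fun v hv => ?_
    obtain ⟨c, rfl⟩ := hsimple v (by
      rw [sub_mulVec, smul_mulVec, one_mulVec, sub_eq_zero] at hv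
      exact hv)
    rw [star_smul, smul_dotProduct, hB, smul_zero]
  have hAH : A.IsHermitian := isHermitian_sub_real (hT α₀) μ
  have hswap : ∀ v w : ι → ℂ, star (star v ⬝ᵥ w) = star w ⬝ᵥ v := by
    intro v w
    simp [dotProduct, mul_comm]
  have hW : star y ⬝ᵥ (matW hT f μ α₀ *ᵥ y) = star y ⬝ᵥ (matOmega T f α₀ *ᵥ y)
      - star (B *ᵥ y) ⬝ᵥ (P *ᵥ (B *ᵥ y)) := by
    rw [matW, sub_mulVec, dotProduct_sub, ← mulVec_mulVec, ← mulVec_mulVec, dotProduct_mulVec _ Bᴴ,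
      star_mulVec]
  have hL : (LinearMap.id + P.mulVecLin ∘ₗ B.mulVecLin ∘ₗ Y : (ι → ℂ) →ₗ[ℂ] (ι → ℂ)) x = x + P *ᵥ (B *ᵥ y) := rfl
  have hmove : ∀ v w : ι → ℂ, star v ⬝ᵥ (A *ᵥ w) = star (A *ᵥ v) ⬝ᵥ w := by
    intro v w
    rw [star_mulVec, hAH.eq, dotProduct_mulVec]
  rw [hAx, hAx, ← Complex.add_re, hL, hAv, hW, hY x, mulVec_add, hAP, star_add, add_dotProduct,
    dotProduct_add, dotProduct_add, hmove (P *ᵥ (B *ᵥ y)) x, hAP, ← hAv x, ← hswap x (B *ᵥ y),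
    ← hswap (B *ᵥ y) (P *ᵥ (B *ᵥ y))]
  simp only [Complex.add_re, Complex.sub_re, RCLike.star_def, Complex.conj_re]
  ring

/-- The local test for global extrema, for a family of matrices depending on the quasimomentum
through the phases of `d` independent edges. -/
theorem extremum_of_edgeFamily {T : (Fin d → ℝ) → Matrix ι ι ℂ}
    (hT : ∀ α, (T α).IsHermitian) (hTe : T = edgeFamily M s t h a)
    (ha : Function.Bijective (edgeMap a)) (n : Fin (Fintype.card ι)) {α₀ : Fin d → ℝ}
    (hcrit : HasFDerivAt (fun α => nthEigenvalue (hT α) n) (0 : (Fin d → ℝ) →L[ℝ] ℝ) α₀)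
    (hsimple : Module.finrank ℂ (Module.End.eigenspace (Matrix.toLin' (T α₀))
      (nthEigenvalue (hT α₀) n : ℂ)) = 1)
    {f : ι → ℂ} (hf : T α₀ *ᵥ f = (nthEigenvalue (hT α₀) n : ℂ) • f)
    (hnorm : star f ⬝ᵥ f = 1) (hfs : ∀ e, f (s e) ≠ 0) :
    ((matW hT f (nthEigenvalue (hT α₀) n) α₀).PosSemidef →
      ∀ α, nthEigenvalue (hT α₀) n ≤ nthEigenvalue (hT α) n) ∧
    ((-(matW hT f (nthEigenvalue (hT α₀) n) α₀)).PosSemidef →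
      ∀ α, nthEigenvalue (hT α) n ≤ nthEigenvalue (hT α₀) n) := by
  have hf0 : f ≠ 0 := by
    rintro rfl
    simp at hnorm
  have hspan : ∀ x : ι → ℂ, T α₀ *ᵥ x = (nthEigenvalue (hT α₀) n : ℂ) • x →
      ∃ c : ℂ, x = c • f := by
    intro x hx
    have hfm : f ∈ Module.End.eigenspace (Matrix.toLin' (T α₀))
        (nthEigenvalue (hT α₀) n : ℂ) := Module.End.mem_eigenspace_iff.2 (by simpa using hf)
    have hxm : x ∈ Module.End.eigenspace (Matrix.toLin' (T α₀))
        (nthEigenvalue (hT α₀) n : ℂ) := Module.End.mem_eigenspace_iff.2 (by simpa using hx)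
    obtain ⟨c, hc⟩ := (finrank_eq_one_iff_of_nonzero' (⟨f, hfm⟩ : Module.End.eigenspace _ _)
      (by simpa using hf0)).1 hsimple ⟨x, hxm⟩
    exact ⟨c, (congrArg Subtype.val hc).symm⟩
  -- Hellmann–Feynman along each coordinate line: `⟨f, ∂_j T f⟩` is the derivative of the band,
  -- which vanishes at `α₀`.
  have hB : ∀ y, star f ⬝ᵥ (matB T f α₀ *ᵥ y) = 0 := by
    have hcol : ∀ j, star f ⬝ᵥ (matB T f α₀).col j = 0 := by
      intro j
      have hentry : ∀ u v, HasLineDerivAt ℝ (fun α => T α u v)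
          (partialDeriv j (fun α => T α u v) α₀) α₀ (Pi.single j 1) := by
        intro u v
        subst hTe
        simp only [edgeFamily_apply]
        exact (hasLineDerivAt_edgeSum h a _ _ _ α₀ j).lineDifferentiableAt.hasLineDerivAt
      have hline : HasLineDerivAt ℝ (fun α => nthEigenvalue (hT α) n) 0 α₀ (Pi.single j 1) := by
        simpa using hcrit.hasLineDerivAt (Pi.single j 1)
      have key := hellmannFeynman (T := fun τ : ℝ => T (α₀ + τ • Pi.single j 1))
        (T' := Matrix.of fun u v => partialDeriv j (fun α => T α u v) α₀)
        (hT _) hentry hline (fun τ => exists_mulVec_eq_nthEigenvalue_smul (hT _) n)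
        (f := f) (by simpa using hf) hnorm (by simpa using hspan)
      have hcolj : (matB T f α₀).col j
          = (Matrix.of fun u v => partialDeriv j (fun α => T α u v) α₀) *ᵥ f := by
        ext u
        have hsum : HasLineDerivAt ℝ (fun α => ∑ v, T α u v * f v)
            (∑ v, partialDeriv j (fun α => T α u v) α₀ * f v) α₀ (Pi.single j 1) :=
          HasDerivAt.fun_sum fun v _ => HasDerivAt.mul_const (hentry u v) (f v)
        exact hsum.lineDeriv
      rw [hcolj, key, Complex.ofReal_zero]
    intro y
    rw [dotProduct_mulVec]
    have : star f ᵥ* matB T f α₀ = 0 := funext hcol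
    rw [this, zero_dotProduct]
  refine ⟨fun hW α => ?_, fun hW α => ?_⟩
  · obtain ⟨L, Y, hLY⟩ := exists_form_sub_eq_form_add_matW hT hTe ha hB hfs hspan α
    refine nthEigenvalue_le_of_form_le (hT α₀) (hT α) n L fun x => ?_
    rw [hLY x]
    have := (Complex.le_def.1 (hW.dotProduct_mulVec_nonneg (Y x))).1
    simp only [Complex.zero_re] at this
    linarith
  · obtain ⟨L, Y, hLY⟩ := exists_form_sub_eq_form_add_matW hT hTe ha hB hfs hspan α
    refine nthEigenvalue_le_of_le_form (hT α₀) (hT α) n L fun x => ?_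
    rw [hLY x]
    have := (Complex.le_def.1 (hW.dotProduct_mulVec_nonneg (Y x))).1
    simp only [Complex.zero_re, neg_mulVec, dotProduct_neg, Complex.neg_re] at this
    linarith

end EdgeFamily

/-! ### Choosing one orientation of each edge. -/

/-- A fixed-point-free involution on a finite type has a set of representatives satisfying any
predicate which holds at one point of each orbit at least. -/
theorem exists_half_of_involutive {E : Type*} [Fintype E] {ρ : E → E}
    (hρ : Function.Involutive ρ) (hne : ∀ e, ρ e ≠ e) {P : E → Prop}
    (hP : ∀ e, P e ∨ P (ρ e)) :
    ∃ O : Finset E, (∀ e, ρ e ∈ O ↔ e ∉ O) ∧ ∀ e ∈ O, P e := by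
  classical
  let i := Fintype.equivFin E
  -- When both points of an orbit satisfy `P`, an arbitrary enumeration breaks the tie.
  refine ⟨Finset.univ.filter fun e => P e ∧ (P (ρ e) → i e < i (ρ e)), fun e => ?_, fun e he => ?_⟩
  · simp only [Finset.mem_filter, Finset.mem_univ, true_and, hρ e]
    have h1 : i e ≠ i (ρ e) := fun h => hne e (i.injective h).symm
    rcases lt_or_gt_of_ne h1 with h | h
    · have := h.not_gt
      have := hP e
      tauto
    · have := h.not_gt
      have := hP e
      tauto
  · exact (Finset.mem_filter.1 he).2.1

theorem sum_eq_sum_half {E M : Type*} [Fintype E] [AddCommMonoid M] {ρ : E → E}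
    (hρ : Function.Involutive ρ) {O : Finset E} (hO : ∀ e, ρ e ∈ O ↔ e ∉ O) (G : E → M) :
    ∑ e, G e = ∑ e : O, (G e + G (ρ e)) := by
  classical
  rw [Finset.sum_coe_sort O (fun e => G e + G (ρ e)), Finset.sum_add_distrib,
    ← Finset.sum_add_sum_compl O G]
  congr 1
  refine Finset.sum_bij' (fun e _ => ρ e) (fun e _ => ρ e) ?_ ?_ ?_ ?_ ?_
  · intro e he
    exact (hO e).2 (Finset.mem_compl.1 he)
  · intro e he
    exact Finset.mem_compl.2 fun h => (hO e).1 h he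
  · intro e _
    exact hρ e
  · intro e _
    exact hρ e
  · intro e _
    rw [hρ e]

/-! ### Freeness of the action and coordinates on the vertices. -/

section Graph

variable {d : ℕ} {V : Type*} [AddAction (Fin d → ℤ) V] {Γ : SimpleGraph V} {F : Finset V}

/-- Fixing a vertex passes to its neighbours up to a positive multiple: the multiples of an element
fixing `w'` permute the finitely many neighbours of `w'`, so two of them agree at `w`. -/
theorem IsPeriodicGraph.exists_nsmul_vadd_eq (hΓ : IsPeriodicGraph (d := d) Γ)
    (hconn : Γ.Connected) {g : Fin d → ℤ} {v : V} (hg : g +ᵥ v = v) (w : V) :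
    ∃ k : ℕ, 0 < k ∧ (k • g) +ᵥ w = w := by
  obtain ⟨p⟩ := hconn.preconnected w v
  induction p with
  | nil => exact ⟨1, one_pos, by simpa using hg⟩
  | @cons w w' v hadj p ih =>
    obtain ⟨k, hk, hkw⟩ := ih hg
    have hfix : ∀ i : ℕ, (i • k • g) +ᵥ w' = w' := by
      intro i
      induction i with
      | zero => simp
      | succ i ih => rw [succ_nsmul, add_vadd, hkw, ih]
    have hmaps : Set.MapsTo (fun i : ℕ => (i • k • g) +ᵥ w) Set.univ (Γ.neighborSet w') := by
      intro i _
      have := (hΓ.adj_vadd_iff (i • k • g) w' w).2 hadj.symm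
      rwa [hfix] at this
    obtain ⟨i, -, j, -, hij, h⟩ := Set.infinite_univ.exists_lt_map_eq_of_mapsTo hmaps
      (hΓ.locally_finite w')
    refine ⟨(j - i) * k, Nat.mul_pos (Nat.sub_pos_of_lt hij) hk, ?_⟩
    have h' : (i • k • g) +ᵥ w = (j • k • g) +ᵥ w := h
    have hsplit : j • k • g = i • k • g + (j - i) • k • g := by
      rw [← add_nsmul, Nat.add_sub_cancel' hij.le]
    rw [hsplit, add_vadd] at h'
    rw [mul_nsmul']
    exact (vadd_left_cancel _ h').symm

/-- The action on a connected periodic graph is free. -/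
theorem IsPeriodicGraph.eq_zero_of_vadd_eq (hΓ : IsPeriodicGraph (d := d) Γ)
    (hconn : Γ.Connected) (hF : IsFundDomain (d := d) F) {g : Fin d → ℤ} {v : V}
    (hg : g +ᵥ v = v) : g = 0 := by
  choose k hk hkw using hΓ.exists_nsmul_vadd_eq hconn hg
  -- A common multiple of the exponents: `K • g` fixes `F` pointwise, hence all of `V` because the
  -- group is commutative. Faithfulness gives `K • g = 0`, and `ℤ^d` is torsion-free.
  set K := ∏ u ∈ F, k u with hK
  have hKpos : 0 < K := Finset.prod_pos fun u _ => hk u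
  have hfixF : ∀ u ∈ F, (K • g) +ᵥ u = u := by
    intro u hu
    obtain ⟨m, hm⟩ := Finset.dvd_prod_of_mem k hu
    have hm' : K = m * k u := by rw [hK, hm, mul_comm]
    rw [hm', mul_nsmul']
    clear hm hm'
    induction m with
    | zero => simp
    | succ m ih => rw [succ_nsmul, add_vadd, hkw, ih]
  have hfix : ∀ w : V, (K • g) +ᵥ w = w := by
    intro w
    obtain ⟨u, ⟨huF, ⟨c, hc⟩⟩, -⟩ := hF w
    have hc : c +ᵥ w = u := hc
    have := hfixF u huF
    rw [← hc, vadd_vadd, add_comm, add_vadd] at this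
    exact vadd_left_cancel _ this
  have := hΓ.faithful
  have h0 : K • g = 0 := FaithfulVAdd.eq_of_vadd_eq_vadd (P := V) fun w => by
    rw [hfix]
    exact (zero_vadd _ w).symm
  exact (smul_eq_zero.1 h0).resolve_left hKpos.ne'

/-- Coordinates on `V` given by a fundamental domain `F` of a free action: `v` is the translate by
`γ v` of the vertex `π v` of `F`. -/
structure IsCoordinates (F : Finset V) (π : V → F) (γ : V → Fin d → ℤ) : Prop where
  vadd_eq : ∀ v, γ v +ᵥ (π v : V) = v
  rep_vadd : ∀ (g : Fin d → ℤ) (u : F), π (g +ᵥ (u : V)) = u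
  shift_vadd : ∀ (g : Fin d → ℤ) (u : F), γ (g +ᵥ (u : V)) = g

/-- Each vertex is a unique translate of a unique vertex of the fundamental domain. -/
theorem IsPeriodicGraph.exists_fundDomain_coordinates (hΓ : IsPeriodicGraph (d := d) Γ)
    (hconn : Γ.Connected) (hF : IsFundDomain (d := d) F) :
    ∃ (π : V → F) (γ : V → Fin d → ℤ), IsCoordinates F π γ := by
  have hex : ∀ v : V, ∃ (u : F) (g : Fin d → ℤ), g +ᵥ (u : V) = v := by
    intro v
    obtain ⟨u, ⟨huF, ⟨c, hc⟩⟩, -⟩ := hF v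
    have hc : c +ᵥ v = u := hc
    exact ⟨⟨u, huF⟩, -c, by simp [← hc]⟩
  choose π γ hπγ using hex
  have hrep : ∀ (g : Fin d → ℤ) (u : F), π (g +ᵥ (u : V)) = u := by
    intro g u
    have h := hπγ (g +ᵥ (u : V))
    refine Subtype.ext ((hF u).unique ⟨(π _).2, ?_⟩ ⟨u.2, AddAction.mem_orbit_self _⟩)
    exact ⟨-γ (g +ᵥ (u : V)) + g, by
      change (-γ (g +ᵥ (u : V)) + g) +ᵥ (u : V) = _
      rw [add_vadd, neg_vadd_eq_iff, h]⟩
  refine ⟨π, γ, hπγ, hrep, fun g u => ?_⟩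
  have h := hπγ (g +ᵥ (u : V))
  rw [hrep] at h
  refine sub_eq_zero.1 (hΓ.eq_zero_of_vadd_eq hconn hF (v := (u : V)) ?_)
  rw [sub_eq_neg_add, add_vadd, h, neg_vadd_vadd]

end Graph

theorem character_eq_edgePhase {O : Type*} {d : ℕ} (b : Module.Basis (Fin d) ℤ (Fin d → ℤ))
    (h : O → ℂ) (γ : O → Fin d → ℤ) (α : Fin d → ℝ) (e : O) :
    h e * character b α (γ e) = edgePhase h (fun e j => (b.repr (γ e) j : ℝ)) e α := by
  simp [character, edgePhase]

/-! ### Crossing edges, their shifts, and the edge form of `T(α)`. -/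

section Crossing

variable {d : ℕ} {V : Type*} [AddAction (Fin d → ℤ) V] {Γ : SimpleGraph V} {F : Finset V}
  {π : V → F} {γ : V → Fin d → ℤ}

theorem IsCoordinates.shift_coe (hc : IsCoordinates F π γ) (u : F) : γ u = 0 := by
  simpa using hc.shift_vadd 0 u

theorem IsCoordinates.mem_iff (hc : IsCoordinates F π γ) (v : V) : v ∈ F ↔ γ v = 0 := by
  refine ⟨fun hv => hc.shift_coe ⟨v, hv⟩, fun hv => ?_⟩
  have := hc.vadd_eq v
  rw [hv, zero_vadd] at this
  exact this ▸ (π v).2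

theorem IsCoordinates.neg_shift_vadd (hc : IsCoordinates F π γ) (v : V) :
    -γ v +ᵥ v = (π v : V) := by
  rw [neg_vadd_eq_iff, hc.vadd_eq]

/-- Reversal of a crossing edge. -/
def reverseCrossing (hΓ : IsPeriodicGraph (d := d) Γ) (hc : IsCoordinates F π γ)
    (e : crossingPairs Γ F) : crossingPairs Γ F :=
  ⟨((π e.1.2 : V), -γ e.1.2 +ᵥ e.1.1), (π e.1.2).2, by
    have h : γ (-γ e.1.2 +ᵥ e.1.1) = -γ e.1.2 := hc.shift_vadd _ ⟨e.1.1, e.2.1⟩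
    rw [hc.mem_iff, h, neg_eq_zero, ← hc.mem_iff]
    exact e.2.2.1, by
    have := (hΓ.adj_vadd_iff (-γ e.1.2) e.1.2 e.1.1).2 e.2.2.2.symm
    rwa [hc.neg_shift_vadd] at this⟩

variable (hΓ : IsPeriodicGraph (d := d) Γ) (hc : IsCoordinates F π γ)

theorem shift_reverseCrossing (e : crossingPairs Γ F) :
    γ (reverseCrossing hΓ hc e).1.2 = -γ e.1.2 :=
  hc.shift_vadd _ ⟨e.1.1, e.2.1⟩

theorem rep_reverseCrossing (e : crossingPairs Γ F) :
    π (reverseCrossing hΓ hc e).1.2 = ⟨e.1.1, e.2.1⟩ :=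
  hc.rep_vadd _ ⟨e.1.1, e.2.1⟩

theorem reverseCrossing_involutive : Function.Involutive (reverseCrossing hΓ hc) := by
  intro e
  apply Subtype.ext
  apply Prod.ext
  · exact congrArg Subtype.val (rep_reverseCrossing hΓ hc e)
  · change -γ (reverseCrossing hΓ hc e).1.2 +ᵥ (π e.1.2 : V) = e.1.2
    rw [shift_reverseCrossing hΓ hc, neg_neg, hc.vadd_eq]

theorem reverseCrossing_ne (e : crossingPairs Γ F) : reverseCrossing hΓ hc e ≠ e := by
  intro h
  have h1 := shift_reverseCrossing hΓ hc e
  rw [h, self_eq_neg] at h1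
  exact e.2.2.1 ((hc.mem_iff _).2 h1)

theorem IsCoordinates.isCrossingEdge (hc : IsCoordinates F π γ) (e : crossingPairs Γ F) :
    IsCrossingEdge (d := d) Γ F ⟨e.1.1, e.2.1⟩ (π e.1.2) :=
  ⟨γ e.1.2, by rw [hc.vadd_eq]; exact e.2.2.1, by rw [hc.vadd_eq]; exact e.2.2.2⟩

/-- In a connected graph the shifts along the crossing edges span the dual of `ℂ^d`. -/
theorem eq_zero_of_crossing_shift_eq_zero (hc : IsCoordinates F π γ)
    (hΓ : IsPeriodicGraph (d := d) Γ) (hconn : Γ.Connected)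
    {ψ : (Fin d → ℤ) →+ ℂ} (hψ : ∀ e : crossingPairs Γ F, ψ (γ e.1.2) = 0) : ψ = 0 := by
  -- Up to translation an edge either stays inside `F`, leaving `γ` unchanged, or is a crossing
  -- pair, whose shift `ψ` kills. Hence `ψ ∘ γ` is constant on the connected graph.
  have hadj : ∀ v w : V, Γ.Adj v w → ψ (γ v) = ψ (γ w) := by
    intro v w hvw
    have h1 : Γ.Adj (π v : V) ((γ w - γ v) +ᵥ (π w : V)) := by
      have := (hΓ.adj_vadd_iff (-γ v) v w).2 hvw
      have h0 : -γ v +ᵥ w = (γ w - γ v) +ᵥ (π w : V) := by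
        rw [sub_eq_neg_add, add_vadd, hc.vadd_eq]
      rwa [hc.neg_shift_vadd, h0] at this
    have h2 : γ ((γ w - γ v) +ᵥ (π w : V)) = γ w - γ v := hc.shift_vadd _ _
    by_cases hmem : (γ w - γ v) +ᵥ (π w : V) ∈ F
    · rw [hc.mem_iff, h2, sub_eq_zero] at hmem
      rw [hmem]
    · have := hψ ⟨((π v : V), (γ w - γ v) +ᵥ (π w : V)), (π v).2, hmem, h1⟩
      change ψ (γ ((γ w - γ v) +ᵥ (π w : V))) = 0 at this
      rw [h2, map_sub, sub_eq_zero] at this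
      exact this.symm
  have hconst : ∀ v w : V, ψ (γ v) = ψ (γ w) := by
    intro v w
    obtain ⟨p⟩ := hconn.preconnected v w
    induction p with
    | nil => rfl
    | cons h _ ih => exact (hadj _ _ h).trans ih
  obtain ⟨v⟩ := hconn.nonempty
  refine AddMonoidHom.ext fun g => ?_
  have := hconst (g +ᵥ (π v : V)) (π v)
  rw [hc.shift_vadd, hc.shift_coe, map_zero] at this
  exact this

/-- One crossing edge per generator makes the system square, so injectivity suffices. A kernel
vector defines an additive `ψ` on `ℤ^d` vanishing on every crossing shift, hence zero. -/
theorem bijective_edgeMap_of_half [Fintype (crossingPairs Γ F)] (hc : IsCoordinates F π γ)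
    (hΓ : IsPeriodicGraph (d := d) Γ) (hconn : Γ.Connected) (b : Module.Basis (Fin d) ℤ (Fin d → ℤ))
    (hcard : Fintype.card (crossingPairs Γ F) = 2 * d) {O : Finset (crossingPairs Γ F)}
    (hO : ∀ e, reverseCrossing hΓ hc e ∈ O ↔ e ∉ O) :
    Function.Bijective (edgeMap fun (e : O) j => (b.repr (γ e.1.1.2) j : ℝ)) := by
  have hOcard : Fintype.card O = d := by
    have := sum_eq_sum_half (reverseCrossing_involutive hΓ hc) hO (fun _ => 1)
    simp only [Finset.sum_const, Finset.card_univ, smul_eq_mul] at this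
    omega
  have hinj : Function.Injective (edgeMap fun (e : O) j => (b.repr (γ e.1.1.2) j : ℝ)) := by
    refine (injective_iff_map_eq_zero _).2 fun y hy => ?_
    let ψ : (Fin d → ℤ) →+ ℂ :=
      { toFun := fun g => ∑ j, (b.repr g j : ℂ) * y j
        map_zero' := by simp
        map_add' := fun g g' => by simp [add_mul, Finset.sum_add_distrib] }
    have hψO : ∀ e ∈ O, ψ (γ e.1.2) = 0 := by
      intro e he
      have := congrFun hy ⟨e, he⟩
      rw [edgeMap_apply] at this
      simpa [ψ] using this
    have hψ : ψ = 0 := by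
      refine eq_zero_of_crossing_shift_eq_zero hc hΓ hconn fun e => ?_
      by_cases he : e ∈ O
      · exact hψO e he
      · have := hψO _ ((hO e).2 he)
        rwa [shift_reverseCrossing hΓ hc, map_neg, neg_eq_zero] at this
    ext j
    have := DFunLike.congr_fun hψ (b j)
    simpa [ψ, Finsupp.single_apply] using this
  exact ⟨hinj, (LinearMap.injective_iff_surjective_of_finrank_eq_finrank (by
    simp [hOcard])).1 hinj⟩

variable [DecidableEq V] {H : ℓ²(V, ℂ) →L[ℂ] ℓ²(V, ℂ)}

/-- The term `g = 0` gives the block of `H` on `F`. For `g ≠ 0` the vertex `gv` is outside `F`, so a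
nonzero entry requires a crossing pair. -/
theorem floquet_eq_add_sum [Fintype (crossingPairs Γ F)] (hc : IsCoordinates F π γ)
    (hH : IsPeriodicOperator (d := d) Γ H)
    (b : Module.Basis (Fin d) ℤ (Fin d → ℤ)) (α : Fin d → ℝ) :
    floquet F b H α = (Matrix.of fun u v : F => entry H (u : V) (v : V))
      + ∑ e : crossingPairs Γ F, Matrix.single (⟨e.1.1, e.2.1⟩ : F) (π e.1.2)
          (entry H e.1.1 e.1.2 * character b α (γ e.1.2)) := by
  classical
  ext u v
  simp only [floquet, of_apply, Matrix.add_apply, Matrix.sum_apply, Matrix.single_apply]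
  have hpt : ∀ g : Fin d → ℤ, entry H (u : V) (g +ᵥ (v : V)) * character b α g
      = (if g = 0 then entry H (u : V) (v : V) else 0) + ∑ e : crossingPairs Γ F,
        (if g = γ e.1.2 then (if (⟨e.1.1, e.2.1⟩ : F) = u ∧ π e.1.2 = v then
          entry H e.1.1 e.1.2 * character b α (γ e.1.2) else 0) else 0) := by
    intro g
    by_cases hg : g = 0
    · rw [Finset.sum_eq_zero]
      · subst hg
        simp [character]
      · intro e _
        rw [if_neg]
        rw [hg]
        exact fun h => e.2.2.1 ((hc.mem_iff _).2 h.symm)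
    · have hnot : g +ᵥ (v : V) ∉ F := by rwa [hc.mem_iff, hc.shift_vadd]
      rw [if_neg hg, zero_add]
      have hiff : ∀ e : crossingPairs Γ F, g = γ e.1.2 →
          ((⟨e.1.1, e.2.1⟩ : F) = u ∧ π e.1.2 = v) → e.1 = ((u : V), g +ᵥ (v : V)) := by
        rintro e h1 ⟨h2, h3⟩
        refine Prod.ext (congrArg Subtype.val h2) ?_
        rw [h1, ← h3, hc.vadd_eq]
      by_cases hadj : Γ.Adj (u : V) (g +ᵥ (v : V))
      · rw [Finset.sum_eq_single (⟨((u : V), g +ᵥ (v : V)), u.2, hnot, hadj⟩ : crossingPairs Γ F)]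
        · simp only [hc.shift_vadd, hc.rep_vadd]
          simp
        · intro e _ he
          split_ifs with h1 h2
          · exact absurd (Subtype.ext (hiff e h1 h2)) he
          · rfl
          · rfl
        · simp
      · rw [hH.entry_eq_zero _ _ (fun h : (u : V) = g +ᵥ (v : V) => hnot (h ▸ u.2)) hadj, zero_mul, Finset.sum_eq_zero]
        intro e _
        split_ifs with h1 h2
        · refine absurd ?_ hadj
          have := hiff e h1 h2
          have hadj' := e.2.2.2
          rw [this] at hadj'
          exact hadj'
        · rfl
        · rfl
  -- `∑ᶠ` is `0` by default on infinite supports, so splitting it requires finite supports.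
  have hfin : ∀ (g₀ : Fin d → ℤ) (c : ℂ),
      (Function.support fun g : Fin d → ℤ => if g = g₀ then c else 0).Finite := fun g₀ c =>
    (Set.finite_singleton g₀).subset fun g hg => by
      by_contra h
      exact hg (if_neg h)
  have hsum : ∀ (g₀ : Fin d → ℤ) (c : ℂ), ∑ᶠ g : Fin d → ℤ, (if g = g₀ then c else 0) = c :=
    fun g₀ c => by
      rw [finsum_eq_single _ g₀ fun g hg => if_neg hg, if_pos rfl]
  rw [finsum_congr hpt, finsum_add_distrib (hfin _ _), hsum, finsum_sum_comm]
  · simp only [hsum]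
  · exact fun e _ => hfin _ _
  · refine (Set.finite_range fun e : crossingPairs Γ F => γ e.1.2).subset fun g hg => ?_
    obtain ⟨e, -, he⟩ := Finset.exists_ne_zero_of_sum_ne_zero hg
    by_contra h
    exact he (if_neg fun h' => h ⟨e, h'.symm⟩)

/-- Self-adjointness and periodicity make the reversed edge contribute the conjugate matrix element
in the transposed position. -/
theorem floquet_eq_edgeFamily [Fintype (crossingPairs Γ F)] (hc : IsCoordinates F π γ)
    (hΓ : IsPeriodicGraph (d := d) Γ)
    (hH : IsPeriodicOperator (d := d) Γ H)
    (b : Module.Basis (Fin d) ℤ (Fin d → ℤ)) {O : Finset (crossingPairs Γ F)}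
    (hO : ∀ e, reverseCrossing hΓ hc e ∈ O ↔ e ∉ O) :
    floquet F b H = edgeFamily (Matrix.of fun u v : F => entry H (u : V) (v : V))
      (fun e : O => ⟨e.1.1.1, e.1.2.1⟩) (fun e : O => π e.1.1.2)
      (fun e : O => entry H e.1.1.1 e.1.1.2) (fun e j => (b.repr (γ e.1.1.2) j : ℝ)) := by
  funext α
  rw [floquet_eq_add_sum hc hH, edgeFamily,
    sum_eq_sum_half (reverseCrossing_involutive hΓ hc) hO]
  congr 1
  refine Finset.sum_congr rfl fun e _ => ?_
  rw [rep_reverseCrossing hΓ hc, shift_reverseCrossing hΓ hc,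
    ← character_eq_edgePhase b _ (fun e : O => γ e.1.1.2), star_mul', ← character_neg,
    entry_conj hH.self_adjoint, ← hH.periodic (-γ e.1.1.2) e.1.1.2]
  rw [hc.neg_shift_vadd]
  rfl

end Crossing

end FloquetBloch

end

/-! ### The main theorem. -/

theorem theorem1p2 {d : ℕ} {V : Type*} [AddAction (Fin d → ℤ) V] [DecidableEq V]
    (Γ : SimpleGraph V) (hΓ : FloquetBloch.IsPeriodicGraph (d := d) Γ)
    -- one crossing edge per generator, with fundamental domain `F`
    (hconn : Γ.Connected)
    (F : Finset V) (hF : FloquetBloch.IsFundDomain (d := d) F)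
    (hcross : (FloquetBloch.crossingPairs Γ F).encard = 2 * d)
    -- any choice of generators of the group `ℤ^d`
    (b : Module.Basis (Fin d) ℤ (Fin d → ℤ))
    (H : ℓ²(V, ℂ) →L[ℂ] ℓ²(V, ℂ)) (hH : FloquetBloch.IsPeriodicOperator (d := d) Γ H)
    (n : Fin (Fintype.card F)) (α₀ : Fin d → ℝ)
    -- `α₀` is a critical point of the band
    (hcrit : HasFDerivAt (FloquetBloch.band hH F b n) (0 : (Fin d → ℝ) →L[ℝ] ℝ) α₀)
    -- the eigenvalue is simple
    (hsimple : Module.finrank ℂ (Module.End.eigenspace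
      (Matrix.toLin' (FloquetBloch.floquet F b H α₀))
      (FloquetBloch.band hH F b n α₀ : ℂ)) = 1)
    -- `f` is the normalized eigenvector
    (f : F → ℂ)
    (hf : FloquetBloch.floquet F b H α₀ *ᵥ f = (FloquetBloch.band hH F b n α₀ : ℂ) • f)
    (hnorm : star f ⬝ᵥ f = 1)
    (hedge : ∀ u v : F, FloquetBloch.IsCrossingEdge (d := d) Γ F u v → f u ≠ 0 ∨ f v ≠ 0) :
    ((FloquetBloch.matW (FloquetBloch.floquet_isHermitian hH F b) f
        (FloquetBloch.band hH F b n α₀) α₀).PosSemidef →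
      ∀ α : Fin d → ℝ, FloquetBloch.band hH F b n α₀ ≤ FloquetBloch.band hH F b n α) ∧
    ((-(FloquetBloch.matW (FloquetBloch.floquet_isHermitian hH F b) f
        (FloquetBloch.band hH F b n α₀) α₀)).PosSemidef →
      ∀ α : Fin d → ℝ, FloquetBloch.band hH F b n α ≤ FloquetBloch.band hH F b n α₀) := by
  classical
  obtain ⟨π, γ, hc⟩ := hΓ.exists_fundDomain_coordinates hconn hF
  have hfin : (FloquetBloch.crossingPairs Γ F).Finite := by
    refine Set.encard_ne_top_iff.1 ?_
    rw [hcross]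
    exact_mod_cast ENat.natCast_ne_top (2 * d)
  have : Fintype (FloquetBloch.crossingPairs Γ F) := hfin.fintype
  have hcard : Fintype.card (FloquetBloch.crossingPairs Γ F) = 2 * d := by
    rw [Set.encard_eq_coe_toFinset_card, Set.toFinset_card] at hcross
    exact_mod_cast hcross
  -- The nonvanishing hypothesis on crossing edges enters here: each edge can be oriented to start
  -- where `f` is nonzero.
  obtain ⟨O, hO, hOf⟩ := FloquetBloch.exists_half_of_involutive
    (FloquetBloch.reverseCrossing_involutive hΓ hc) (FloquetBloch.reverseCrossing_ne hΓ hc)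
    (P := fun e => f ⟨e.1.1, e.2.1⟩ ≠ 0) fun e => hedge _ _ (hc.isCrossingEdge e)
  exact FloquetBloch.extremum_of_edgeFamily (FloquetBloch.floquet_isHermitian hH F b)
    (FloquetBloch.floquet_eq_edgeFamily hc hΓ hH b hO)
    (FloquetBloch.bijective_edgeMap_of_half hc hΓ hconn b hcard hO) n hcrit hsimple hf hnorm
    fun e => hOf e.1 e.2
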